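/- Let $p\ge 5$ be a prime and let $\mathbb F$ be a field of characteristic $p$. For $i,j\ge 1$ let $a_{i,j}\in\{-1,0,1\}$ be the integer with $a_{i,j}\equiv j-i\pmod 3$. Let $n_+(A_1^{(1)})$ be the Lie algebra over $\mathbb F$ with basis $e_1,e_2,e_3,\dots$ and bracket $[e_i,e_j]=a_{i,j}e_{i+j}$, let $(e_{p+1})$ be its ideal generated by $e_{p+1}$, and let $\mathfrak g(p)=n_+(A_1^{(1)})/(e_{p+1})$, which has the classes of $e_1,\dots,e_p$ as a basis. Let $C^q=(\bigwedge^q\mathfrak g(p))^*$ be the space of $q$-cochains with trivial coefficients, and let $d^1:C^1\to C^2$ and $d^2:C^2\to C^3$ be the differentials $$d^1(\psi)(g\wedge h)=\psi([g,h]),\qquad d^2(\varphi)(g\wedge h\wedge f)=\varphi([g,h]\wedge f)-\varphi([g,f]\wedge h)+\varphi([h,f]\wedge g),$$ so that $d^2d^1=0$ and $H^2(\mathfrak g(p))=\ker d^2/\operatorname{im} d^1$. Let $e^k$ ($1\le k\le p$) be the basis of $C^1$ dual to the $e_k$, and let $e^{i,j}$ ($1\le i<j\le p$) be the basis of $C^2$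 dual to the $e_i\wedge e_j$. For $3\le k\le p+1$ put $$\varphi_k=\sum_{1\le i<k-i}a_{i,k-i}\,e^{i,k-i}.$$ Then: 1. The family $e^{1,4},\ e^{2,5},\ \varphi_3,\varphi_4,\dots,\varphi_{p+1}$ is a basis of $\ker d^2$; in particular $\dim\ker d^2=p+1$. 2. $\varphi_k=d^1(e^k)$ for $3\le k\le p$. 3. $\dim H^2(\mathfrak g(p))=3$, and the classes of $e^{1,4}$, $e^{2,5}$ and $\varphi_{p+1}$ form a basis of $H^2(\mathfrak g(p))$. -/

import Mathlib

/-! ### The Lie algebra `n_+(A_1^{(1)})` and its truncation `g(p)` -/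

/-- The structure constants: `a i j` is the representative in `{-1, 0, 1}` of `j - i` modulo `3`. -/
def aCoeff (i j : ℕ) : ℤ :=
  if (j : ℤ) - i ≡ 1 [ZMOD 3] then 1
  else if (j : ℤ) - i ≡ -1 [ZMOD 3] then -1
  else 0

theorem aCoeff_self (i : ℕ) : aCoeff i i = 0 := by
  simp [aCoeff, Int.ModEq]

theorem aCoeff_skew (i j : ℕ) : aCoeff j i = -aCoeff i j := by
  simp only [aCoeff, Int.ModEq]
  split_ifs <;> first | rfl | omega

theorem aCoeff_mod (i j : ℕ) : aCoeff i j = aCoeff (i % 3) (j % 3) := by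
  simp only [aCoeff, Int.ModEq]
  split_ifs <;> first | rfl | omega

theorem aCoeff_jacobi (i j k : ℕ) :
    aCoeff j k * aCoeff i (j + k)
      = aCoeff i j * aCoeff (i + j) k + aCoeff i k * aCoeff j (i + k) := by
  have key : ∀ x < 3, ∀ y < 3, ∀ z < 3, aCoeff y z * aCoeff x ((y + z) % 3)
      = aCoeff x y * aCoeff ((x + y) % 3) z + aCoeff x z * aCoeff y ((x + z) % 3) := by
    decide
  have h := key (i % 3) (Nat.mod_lt _ (by norm_num)) (j % 3) (Nat.mod_lt _ (by norm_num))
    (k % 3) (Nat.mod_lt _ (by norm_num))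
  simp only [← Nat.add_mod] at h
  rw [aCoeff_mod j k, aCoeff_mod i (j + k), aCoeff_mod i j, aCoeff_mod (i + j) k,
    aCoeff_mod i k, aCoeff_mod j (i + k)]
  exact h

/-- `n_+(A_1^{(1)})`: the vector space over `F` with basis `e_1, e_2, e_3, …`. -/
def NPlus (F : Type*) [Field F] : Type _ := ℕ+ →₀ F

namespace NPlus

variable {F : Type*} [Field F]

noncomputable instance : AddCommGroup (NPlus F) := inferInstanceAs (AddCommGroup (ℕ+ →₀ F))

noncomputable instance : Module F (NPlus F) := inferInstanceAs (Module F (ℕ+ →₀ F))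

/-- The basis vector `e_i`, `i ≥ 1`. -/
noncomputable def e (i : ℕ+) : NPlus F := (Finsupp.single i 1 : ℕ+ →₀ F)

/-- The `i`-th coordinate with respect to the basis `e_1, e_2, …`. -/
noncomputable def coord (i : ℕ+) : NPlus F →ₗ[F] F := (Finsupp.lapply i : (ℕ+ →₀ F) →ₗ[F] F)

/-- The vectors `e_1, e_2, …` as a basis. -/
noncomputable def basis : Module.Basis ℕ+ F (NPlus F) := Module.Basis.ofRepr (LinearEquiv.refl F (ℕ+ →₀ F))

theorem basis_apply (i : ℕ+) : (basis i : NPlus F) = e i := rfl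

theorem coord_e (i j : ℕ+) : coord i (e j : NPlus F) = if j = i then 1 else 0 := by
  show (Finsupp.single j (1 : F)) i = _
  rw [Finsupp.single_apply]

/-- The bilinear map with `[e_i, e_j] = a_{i,j} e_{i+j}`. -/
noncomputable def bracket : NPlus F →ₗ[F] NPlus F →ₗ[F] NPlus F :=
  basis.constr F fun i : ℕ+ => basis.constr F fun j : ℕ+ => (aCoeff i j : F) • e (i + j)

theorem bracket_e (i j : ℕ+) :
    bracket (e i : NPlus F) (e j) = (aCoeff i j : F) • e (i + j) := by
  rw [← basis_apply, ← basis_apply, bracket, Module.Basis.constr_basis, Module.Basis.constr_basis]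

theorem bracket_skew (x y : NPlus F) : bracket x y = -bracket y x := by
  have h : (bracket : NPlus F →ₗ[F] NPlus F →ₗ[F] NPlus F) = -bracket.flip := by
    refine basis.ext fun i => basis.ext fun j => ?_
    simp only [LinearMap.neg_apply, LinearMap.flip_apply, basis_apply, bracket_e]
    rw [aCoeff_skew j i, add_comm j i]
    simp
  exact LinearMap.congr_fun (LinearMap.congr_fun h x) y

theorem bracket_self (x : NPlus F) : bracket x x = 0 := by
  have hx : x ∈ Submodule.span F (Set.range (basis : Module.Basis ℕ+ F (NPlus F))) := by
    simp [basis.span_eq]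
  induction hx using Submodule.span_induction with
  | mem x hx =>
    obtain ⟨i, rfl⟩ := hx
    simp [basis_apply, bracket_e, aCoeff_self]
  | zero => simp
  | add x y _ _ hx hy => simp [hx, hy, bracket_skew y x]
  | smul c x _ hx => simp [hx]

theorem bracket_leibniz (x y z : NPlus F) :
    bracket x (bracket y z) = bracket (bracket x y) z + bracket y (bracket x z) := by
  have hx : x ∈ Submodule.span F (Set.range (basis : Module.Basis ℕ+ F (NPlus F))) := by
    simp [basis.span_eq]
  have hy : y ∈ Submodule.span F (Set.range (basis : Module.Basis ℕ+ F (NPlus F))) := by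
    simp [basis.span_eq]
  have hz : z ∈ Submodule.span F (Set.range (basis : Module.Basis ℕ+ F (NPlus F))) := by
    simp [basis.span_eq]
  induction hx using Submodule.span_induction with
  | zero => simp
  | add x x' _ _ hx hx' => simp only [map_add, LinearMap.add_apply, hx, hx']; abel
  | smul c x _ hx => simp [hx]
  | mem x hx =>
  induction hy using Submodule.span_induction with
  | zero => simp
  | add x x' _ _ hx hx' => simp only [map_add, LinearMap.add_apply, hx, hx']; abel
  | smul c x _ hx => simp [hx]
  | mem y hy =>
  induction hz using Submodule.span_induction with
  | zero => simp
  | add x x' _ _ hx hx' => simp only [map_add, hx, hx']; abel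
  | smul c x _ hx => simp [hx]
  | mem z hz =>
  obtain ⟨i, rfl⟩ := hx
  obtain ⟨j, rfl⟩ := hy
  obtain ⟨k, rfl⟩ := hz
  have h := congrArg (Int.cast : ℤ → F) (aCoeff_jacobi i j k)
  push_cast at h
  simp only [basis_apply, bracket_e, map_smul, LinearMap.smul_apply, smul_smul, PNat.add_coe]
  rw [h, add_left_comm j i k, ← add_assoc i j k, add_smul]

noncomputable instance : LieRing (NPlus F) where
  bracket x y := bracket x y
  add_lie x y z := by simp
  lie_add x y z := by simp
  lie_self x := bracket_self x
  leibniz_lie x y z := bracket_leibniz x y z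

noncomputable instance : LieAlgebra F (NPlus F) where
  lie_smul c x y := map_smul (bracket x) c y

theorem lie_e (i j : ℕ+) : ⁅(e i : NPlus F), (e j : NPlus F)⁆ = (aCoeff i j : F) • e (i + j) :=
  bracket_e i j

end NPlus


section Truncated

variable (F : Type*) [Field F] (p : ℕ)

/-- The ideal `(e_{p+1})` of `n_+(A_1^{(1)})` generated by `e_{p+1}`. -/
noncomputable def truncIdeal : LieIdeal F (NPlus F) :=
  LieSubmodule.lieSpan F (NPlus F) {NPlus.e p.succPNat}

/-- The Lie algebra `g(p) = n_+(A_1^{(1)}) / (e_{p+1})`. -/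
abbrev TruncNPlus : Type _ := NPlus F ⧸ truncIdeal F p

/-- The coordinate `i ≤ p` of an element of `n_+(A_1^{(1)})` only depends on its class in `g(p)`. -/
theorem truncIdeal_le_ker_coord (i : ℕ+) (hi : (i : ℕ) ≤ p) :
    (truncIdeal F p).toSubmodule ≤ LinearMap.ker (NPlus.coord i : NPlus F →ₗ[F] F) := by
  let J : LieIdeal F (NPlus F) :=
    { carrier := {x | ∀ i : ℕ+, (i : ℕ) ≤ p → NPlus.coord i x = 0}
      add_mem' := by
        intro x y hx hy i hi
        rw [map_add, hx i hi, hy i hi, add_zero]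
      zero_mem' := by
        intro i _
        simp
      smul_mem' := by
        intro c x hx i hi
        rw [map_smul, hx i hi, smul_zero]
      lie_mem := by
        intro x y hy i hi
        have hx : x ∈ Submodule.span F (Set.range (NPlus.basis : Module.Basis ℕ+ F _)) := by
          simp [NPlus.basis.span_eq]
        induction hx using Submodule.span_induction with
        | zero => simp
        | add x x' _ _ hx hx' => rw [add_lie, map_add, hx, hx', add_zero]
        | smul c x _ hx => rw [smul_lie, map_smul, hx, smul_zero]
        | mem x hx =>
        obtain ⟨a, rfl⟩ := hx
        rw [← NPlus.basis.linearCombination_repr y, Finsupp.linearCombination_apply, Finsupp.sum,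
          lie_sum, map_sum]
        refine Finset.sum_eq_zero fun j _ => ?_
        rw [lie_smul, NPlus.basis_apply, NPlus.basis_apply, NPlus.lie_e, map_smul, map_smul,
          NPlus.coord_e]
        split_ifs with h
        · have hj : (j : ℕ) ≤ p := by
            rw [← h, PNat.add_coe] at hi
            omega
          have : NPlus.basis.repr y j = 0 := hy j hj
          rw [this, zero_smul]
        · simp }
  have hJ : truncIdeal F p ≤ J := by
    rw [truncIdeal, LieSubmodule.lieSpan_le]
    rintro _ rfl i hi
    rw [NPlus.coord_e, if_neg]
    intro h
    rw [← h] at hi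
    simp at hi
  intro x hx
  exact hJ hx i hi

/-- The class of `e_i` in `g(p)`. -/
noncomputable def truncE (i : ℕ+) : TruncNPlus F p :=
  LieSubmodule.Quotient.mk (NPlus.e i)

/-- The vector `e^i` of `g(p)^*`, for `1 ≤ i ≤ p`, dual to the basis `e_1, …, e_p` of `g(p)`: it
sends a class to its `i`-th coordinate. It is set to `0` for `i` outside this range. -/
noncomputable def dualE (i : ℕ) : Module.Dual F (TruncNPlus F p) :=
  if h : 0 < i ∧ i ≤ p then
    (truncIdeal F p).toSubmodule.liftQ (NPlus.coord (Nat.toPNat i h.1))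
      (truncIdeal_le_ker_coord F p (Nat.toPNat i h.1) h.2)
  else 0

theorem dualE_truncE (i : ℕ) (hi : 0 < i) (hip : i ≤ p) (j : ℕ+) :
    dualE F p i (truncE F p j) = if (j : ℕ) = i then 1 else 0 := by
  rw [dualE, dif_pos ⟨hi, hip⟩]
  have h := NPlus.coord_e (F := F) (Nat.toPNat i hi) j
  simp only [← PNat.coe_inj] at h
  exact h

theorem e_mem_truncIdeal (hp : ¬ 3 ∣ p) (k : ℕ+) (hk : p < k) :
    (NPlus.e k : NPlus F) ∈ truncIdeal F p := by
  induction k using PNat.strongInductionOn with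
  | _ k ih =>
  by_cases h1 : (k : ℕ) = p + 1
  · have : k = p.succPNat := PNat.eq (by simpa using h1)
    rw [this]
    exact LieSubmodule.subset_lieSpan rfl
  have step (a j : ℕ) (ha0 : 0 < a) (hj0 : 0 < j) (haj : a + j = k) (hj : p < j)
      (ha : aCoeff a j = 1 ∨ aCoeff a j = -1) : (NPlus.e k : NPlus F) ∈ truncIdeal F p := by
    lift a to ℕ+ using ha0
    lift j to ℕ+ using hj0
    replace haj : a + j = k := PNat.eq haj
    have hlt : j < k := by
      rw [← haj]
      exact PNat.lt_add_left j a
    have h := (truncIdeal F p).lie_mem (x := NPlus.e a) (ih j hlt hj)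
    rw [NPlus.lie_e, haj] at h
    rcases ha with ha | ha
    · simpa [ha] using h
    · simpa [ha] using (truncIdeal F p).neg_mem h
  by_cases h2 : (k : ℕ) % 3 = 2
  · refine step 2 (k - 2) (by omega) (by omega) (by omega) (by omega) (Or.inl ?_)
    rw [aCoeff_mod, show ((k : ℕ) - 2) % 3 = 0 by omega]
    decide
  · refine step 1 (k - 1) (by omega) (by omega) (by omega) (by omega) ?_
    rw [aCoeff_mod]
    obtain h | h : ((k : ℕ) - 1) % 3 = 0 ∨ ((k : ℕ) - 1) % 3 = 2 := by omega
    all_goals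
      rw [h]
      decide

/-- For `3 ∤ p`, in particular for a prime `p ≥ 5`, the classes of `e_1, …, e_p` are a basis of
`g(p)`, and `e^1, …, e^p` is its dual basis. -/
theorem exists_basis_truncE (hp : ¬ 3 ∣ p) :
    ∃ b : Module.Basis (Fin p) F (TruncNPlus F p), ∀ i : Fin p,
      b i = truncE F p (i : ℕ).succPNat ∧ b.coord i = dualE F p (i + 1) := by
  have hdual (i j : Fin p) : dualE F p (i + 1) (truncE F p (j : ℕ).succPNat)
      = if j = i then 1 else 0 := by
    rw [dualE_truncE F p (i + 1) (by omega) (by omega)]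
    simp [Fin.ext_iff]
  have hli : LinearIndependent F fun i : Fin p => truncE F p (i : ℕ).succPNat := by
    rw [Fintype.linearIndependent_iff]
    intro g hg i
    have h := congrArg (dualE F p (i + 1)) hg
    simpa [map_sum, hdual] using h
  have hsp : ⊤ ≤ Submodule.span F (Set.range fun i : Fin p => truncE F p (i : ℕ).succPNat) := by
    rintro x -
    obtain ⟨x, rfl⟩ := LieSubmodule.Quotient.surjective_mk' (truncIdeal F p) x
    have hx : x ∈ Submodule.span F (Set.range (NPlus.basis : Module.Basis ℕ+ F _)) := by
      simp [NPlus.basis.span_eq]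
    induction hx using Submodule.span_induction with
    | zero => simp
    | add x x' _ _ hx hx' => rw [map_add]; exact Submodule.add_mem _ hx hx'
    | smul c x _ hx => rw [map_smul]; exact Submodule.smul_mem _ c hx
    | mem x hx =>
    obtain ⟨k, rfl⟩ := hx
    rw [NPlus.basis_apply]
    by_cases hk : (k : ℕ) ≤ p
    · refine Submodule.subset_span ⟨⟨k - 1, ?_⟩, ?_⟩
      · have := k.pos
        omega
      · have : (k - 1 : ℕ).succPNat = k := PNat.eq (by
          have := k.pos
          simp only [Nat.succPNat_coe]
          omega)
        simp only [this]
        rfl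
    · rw [(LieSubmodule.Quotient.mk_eq_zero (truncIdeal F p)).mpr (e_mem_truncIdeal F p hp k (by omega))]
      exact Submodule.zero_mem _
  refine ⟨Module.Basis.mk hli hsp, fun i => ⟨Module.Basis.mk_apply hli hsp i, ?_⟩⟩
  refine (Module.Basis.mk hli hsp).ext fun j => ?_
  rw [Module.Basis.coord_apply, Module.Basis.repr_self, Module.Basis.mk_apply, hdual,
    Finsupp.single_apply]

end Truncated

/-! ### Low-degree Chevalley–Eilenberg cochains with trivial coefficients

`C^1 = L^*`, and `C^q = (⋀^q L)^*` is the space of alternating `q`-linear forms for `q = 2, 3`. -/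

section Cochains

variable (F L : Type*) [Field F] [LieRing L] [LieAlgebra F L]

/-- The space `C^q = (⋀^q L)^*` of alternating `q`-linear forms on `L`. -/
def Cochain (q : ℕ) : Type _ := L [⋀^Fin q]→ₗ[F] F

namespace Cochain

instance (q : ℕ) : AddCommGroup (Cochain F L q) :=
  inferInstanceAs (AddCommGroup (L [⋀^Fin q]→ₗ[F] F))

instance (q : ℕ) : Module F (Cochain F L q) :=
  inferInstanceAs (Module F (L [⋀^Fin q]→ₗ[F] F))

instance (q : ℕ) : FunLike (Cochain F L q) (Fin q → L) F :=
  inferInstanceAs (FunLike (L [⋀^Fin q]→ₗ[F] F) (Fin q → L) F)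

variable {F L} {q : ℕ}

@[ext]
theorem ext {φ φ' : Cochain F L q} (h : ∀ v, φ v = φ' v) : φ = φ' := DFunLike.ext φ φ' h

@[simp]
theorem add_apply (φ φ' : Cochain F L q) (v : Fin q → L) : (φ + φ') v = φ v + φ' v := rfl

@[simp]
theorem smul_apply (c : F) (φ : Cochain F L q) (v : Fin q → L) : (c • φ) v = c * φ v := rfl

@[simp]
theorem zero_apply (v : Fin q → L) : (0 : Cochain F L q) v = 0 := rfl

theorem apply_add_left (φ : Cochain F L 2) (x x' y : L) :
    φ ![x + x', y] = φ ![x, y] + φ ![x', y] := by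
  have h : ∀ z, Function.update ![x, y] 0 z = ![z, y] := fun z => by
    ext i
    fin_cases i <;> rfl
  have h' := AlternatingMap.map_update_add (φ : L [⋀^Fin 2]→ₗ[F] F) ![x, y] 0 x x'
  simp only [h] at h'
  exact h'

theorem apply_smul_left (φ : Cochain F L 2) (c : F) (x y : L) :
    φ ![c • x, y] = c * φ ![x, y] := by
  have h : ∀ z, Function.update ![x, y] 0 z = ![z, y] := fun z => by
    ext i
    fin_cases i <;> rfl
  have h' := AlternatingMap.map_update_smul (φ : L [⋀^Fin 2]→ₗ[F] F) ![x, y] 0 c x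
  simp only [h] at h'
  exact h'

theorem apply_self (φ : Cochain F L 2) (x : L) : φ ![x, x] = 0 :=
  AlternatingMap.map_eq_zero_of_eq (φ : L [⋀^Fin 2]→ₗ[F] F) ![x, x] (i := 0) (j := 1) rfl
    (by decide)

theorem apply_add_right (φ : Cochain F L 2) (x y y' : L) :
    φ ![x, y + y'] = φ ![x, y] + φ ![x, y'] := by
  have h : ∀ z, Function.update ![x, y] 1 z = ![x, z] := fun z => by
    ext i
    fin_cases i <;> rfl
  have h' := AlternatingMap.map_update_add (φ : L [⋀^Fin 2]→ₗ[F] F) ![x, y] 1 y y'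
  simp only [h] at h'
  exact h'

theorem apply_smul_right (φ : Cochain F L 2) (c : F) (x y : L) :
    φ ![x, c • y] = c * φ ![x, y] := by
  have h : ∀ z, Function.update ![x, y] 1 z = ![x, z] := fun z => by
    ext i
    fin_cases i <;> rfl
  have h' := AlternatingMap.map_update_smul (φ : L [⋀^Fin 2]→ₗ[F] F) ![x, y] 1 c y
  simp only [h] at h'
  exact h'

theorem apply_zero_left (φ : Cochain F L 2) (y : L) : φ ![0, y] = 0 := by
  simpa using φ.apply_smul_left 0 0 y

end Cochain

/-- `d^1(ψ)(g ∧ h) = ψ([g, h])`. -/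
def ceD1 : Module.Dual F L →ₗ[F] Cochain F L 2 where
  toFun ψ :=
    ({toFun := fun v => ψ ⁅v 0, v 1⁆
      map_update_add' := by
        intro inst v i x y
        obtain rfl : inst = instDecidableEqFin 2 := Subsingleton.elim _ _
        fin_cases i <;> simp
      map_update_smul' := by
        intro inst v i c x
        obtain rfl : inst = instDecidableEqFin 2 := Subsingleton.elim _ _
        fin_cases i <;> simp
      map_eq_zero_of_eq' := by
        intro v i j hij hne
        fin_cases i <;> fin_cases j <;> simp_all } : L [⋀^Fin 2]→ₗ[F] F)
  map_add' _ _ := rfl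
  map_smul' _ _ := rfl

/-- `d^2(φ)(g ∧ h ∧ f) = φ([g, h] ∧ f) - φ([g, f] ∧ h) + φ([h, f] ∧ g)`. -/
def ceD2 : Cochain F L 2 →ₗ[F] Cochain F L 3 where
  toFun φ :=
    ({toFun := fun v =>
        φ ![⁅v 0, v 1⁆, v 2] - φ ![⁅v 0, v 2⁆, v 1] + φ ![⁅v 1, v 2⁆, v 0]
      map_update_add' := by
        intro inst v i x y
        obtain rfl : inst = instDecidableEqFin 3 := Subsingleton.elim _ _
        obtain rfl | rfl | rfl : i = 0 ∨ i = 1 ∨ i = 2 := by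
          fin_cases i
          all_goals decide
        all_goals
          simp [Cochain.apply_add_left, Cochain.apply_add_right]; ring
      map_update_smul' := by
        intro inst v i c x
        obtain rfl : inst = instDecidableEqFin 3 := Subsingleton.elim _ _
        obtain rfl | rfl | rfl : i = 0 ∨ i = 1 ∨ i = 2 := by
          fin_cases i
          all_goals decide
        all_goals
          simp [Cochain.apply_smul_left, Cochain.apply_smul_right]; ring
      map_eq_zero_of_eq' := by
        intro v i j hij hne
        have h (x y z : L) : φ ![⁅x, y⁆, z] = -φ ![⁅y, x⁆, z] := by
          rw [← lie_skew, ← neg_one_smul F, φ.apply_smul_left]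
          ring
        have key : ∀ v : Fin 3 → L, v 0 = v 1 ∨ v 0 = v 2 ∨ v 1 = v 2 →
            φ ![⁅v 0, v 1⁆, v 2] - φ ![⁅v 0, v 2⁆, v 1] + φ ![⁅v 1, v 2⁆, v 0] = 0 := by
          rintro v (hv | hv | hv)
          · rw [hv, lie_self, φ.apply_zero_left]; ring
          · rw [hv, lie_self, φ.apply_zero_left, h (v 2) (v 1)]; ring
          · rw [hv, lie_self, φ.apply_zero_left]; ring
        apply key
        have hi : i = 0 ∨ i = 1 ∨ i = 2 := by fin_cases i <;> decide
        have hj : j = 0 ∨ j = 1 ∨ j = 2 := by fin_cases j <;> decide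
        rcases hi with rfl | rfl | rfl <;> rcases hj with rfl | rfl | rfl <;>
          first
          | exact absurd rfl hne
          | exact Or.inl hij
          | exact Or.inl hij.symm
          | exact Or.inr (Or.inl hij)
          | exact Or.inr (Or.inl hij.symm)
          | exact Or.inr (Or.inr hij)
          | exact Or.inr (Or.inr hij.symm) } : L [⋀^Fin 3]→ₗ[F] F)
  map_add' φ φ' := by
    ext v
    show (φ + φ') _ - (φ + φ') _ + (φ + φ') _ = φ _ - φ _ + φ _ + (φ' _ - φ' _ + φ' _)
    simp only [Cochain.add_apply]
    ring
  map_smul' c φ := by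
    ext v
    show (c • φ) _ - (c • φ) _ + (c • φ) _ = c * (φ _ - φ _ + φ _)
    simp only [Cochain.smul_apply]
    ring

theorem ceD2_ceD1 (ψ : Module.Dual F L) : ceD2 F L (ceD1 F L ψ) = 0 := by
  ext v
  show ψ ⁅⁅v 0, v 1⁆, v 2⁆ - ψ ⁅⁅v 0, v 2⁆, v 1⁆ + ψ ⁅⁅v 1, v 2⁆, v 0⁆ = 0
  have h := congrArg ψ (lie_jacobi (v 0) (v 1) (v 2))
  rw [← lie_skew (v 2) (v 0)] at h
  rw [← lie_skew ⁅v 0, v 1⁆, ← lie_skew ⁅v 0, v 2⁆, ← lie_skew ⁅v 1, v 2⁆]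
  simp only [map_add, map_neg, lie_neg, map_zero] at h ⊢
  linear_combination -h

/-- The coboundaries `im d^1`, as a subspace of the cocycles `ker d^2`. -/
def coboundaries2 : Submodule F (LinearMap.ker (ceD2 F L)) :=
  LinearMap.range ((ceD1 F L).codRestrict (LinearMap.ker (ceD2 F L))
    fun ψ => LinearMap.mem_ker.mpr (ceD2_ceD1 F L ψ))

/-- `H^2(L) = ker d^2 / im d^1`, the second cohomology of `L` with trivial coefficients. -/
abbrev H2 : Type _ := LinearMap.ker (ceD2 F L) ⧸ coboundaries2 F L

variable {F L}

/-- The wedge product of two linear forms, `(α ∧ β)(g ∧ h) = α(g) β(h) - α(h) β(g)`. -/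
def wedge (α β : Module.Dual F L) : Cochain F L 2 :=
  ({toFun := fun v => α (v 0) * β (v 1) - α (v 1) * β (v 0)
    map_update_add' := by
      intro inst v i x y
      obtain rfl : inst = instDecidableEqFin 2 := Subsingleton.elim _ _
      fin_cases i <;> simp <;> ring
    map_update_smul' := by
      intro inst v i c x
      obtain rfl : inst = instDecidableEqFin 2 := Subsingleton.elim _ _
      fin_cases i <;> simp <;> ring
    map_eq_zero_of_eq' := by
      intro v i j hij hne
      fin_cases i <;> fin_cases j <;> simp_all } : L [⋀^Fin 2]→ₗ[F] F)

end Cochains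

/-! ### The cochains `e^{i,j}` and `φ_k` on `g(p)` -/

section Phi

variable (F : Type*) [Field F] (p : ℕ)

/-- `e^{i,j}`, the vector of `(⋀^2 g(p))^*` dual to `e_i ∧ e_j`. -/
noncomputable def dualE2 (i j : ℕ) : Cochain F (TruncNPlus F p) 2 :=
  wedge (dualE F p i) (dualE F p j)

/-- `s(k)` is the largest `i` with `i < k - i`. -/
def sIdx (k : ℕ) : ℕ := if Even k then k / 2 - 1 else (k - 1) / 2

/-- `M(p, k)` is the smallest `i ≥ 1` with `k - i ≤ p`. -/
def mIdx (p k : ℕ) : ℕ := if k ≤ p + 1 then 1 else k - p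

/-- `φ_k = ∑ a_{i,k-i} e^{i,k-i}`, the sum over all `i` with `1 ≤ i < k - i ≤ p`. -/
noncomputable def phi (k : ℕ) : Cochain F (TruncNPlus F p) 2 :=
  ∑ i ∈ Finset.Icc (mIdx p k) (sIdx k), (aCoeff i (k - i) : F) • dualE2 F p i (k - i)

end Phi

/-! A 2-cochain is determined by its values x(i, j) on pairs of basis vectors. Since 3 ∤ p, every
e_k with k > p lies in the ideal, so x can be read as a skew function on all pairs of positive
integers, vanishing as soon as an index exceeds p. The cocycle identity for e_i, e_j, e_k only
involves values of weight n = i + j + k, so each weight can be treated alone, with one unknown x(i,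
n - i) for each i.

In a fixed weight, the identities containing e_1 or e_2 are recurrences in i, with coefficients
depending only on residues modulo 3. Together with skewness they show that one value, at (1, n - 1)
or, when n ≡ 2 (mod 3), at (2, n - 2), controls the whole weight. The exceptions are n = 5 and n =
7, where the skewness relation degenerates and x(1, 4), respectively x(2, 5), remains free. For n ≡
0 the argument divides by n/3, which is legitimate because n ≤ 2p. These are the three
`weight_eq_zero_of_mod_*` lemmas. For n ≥ p + 2 the controlling value is already zero by truncation,
so `eq_zero_of_mem_ker` leaves at most p + 1 parameters.

Conversely, φ_k is a cocycle by the Jacobi identity, and e^{1,4}, e^{2,5} are cocycles by a finite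
check. Evaluating at the controlling pairs gives dual coordinates, hence a basis of cocycles. The
differentials of e^1 and e^2 vanish and those of e^3, …, e^p are φ_3, …, φ_p, so exactly three basis
classes survive. On n_+ the form φ_{p+1} would be the coboundary of e^{p+1}, which does not exist on
g(p). -/

/-! ### Structure constants by residue modulo 3 -/

theorem aCoeff_eq_zero {i j : ℕ} (h : i % 3 = j % 3) : aCoeff i j = 0 := by
  simp only [aCoeff, Int.ModEq]
  split_ifs <;> first | rfl | omega

theorem aCoeff_eq_one {i j : ℕ} (h : (i + 1) % 3 = j % 3) : aCoeff i j = 1 := by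
  simp only [aCoeff, Int.ModEq]
  split_ifs <;> first | rfl | omega

theorem aCoeff_eq_neg_one {i j : ℕ} (h : (i + 2) % 3 = j % 3) : aCoeff i j = -1 := by
  simp only [aCoeff, Int.ModEq]
  split_ifs <;> first | rfl | omega

/-! ### Cocycle recurrences in a fixed weight -/

section Weight

variable {F : Type*} [Field F]

/-- A skew-symmetric function on pairs of positive integers which satisfies the cocycle identity of
`n_+(A_1^{(1)})`. -/
structure IsCocycleFun (x : ℕ → ℕ → F) : Prop where
  skew : ∀ i j, 0 < i → 0 < j → x i j = -x j i
  cocycle : ∀ i j k, 0 < i → 0 < j → 0 < k →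
    (aCoeff i j : F) * x (i + j) k - aCoeff i k * x (i + k) j + aCoeff j k * x (j + k) i = 0

namespace IsCocycleFun

variable {x : ℕ → ℕ → F} {n : ℕ}

theorem weight_skew (hx : IsCocycleFun x) {i j : ℕ} (hi : 0 < i) (hj : 0 < j) (h : i + j = n) :
    x i (n - i) = -x j (n - j) := by
  rw [show n - i = j by omega, show n - j = i by omega]
  exact hx.skew i j hi hj

/-- The cocycle identity for `e_i, e_j, e_{n-i-j}`. -/
theorem weight_cocycle (hx : IsCocycleFun x) (i j : ℕ) (hi : 0 < i) (hj : 0 < j)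
    (h : i + j < n) :
    (aCoeff i j : F) * x (i + j) (n - (i + j)) + aCoeff i (n - i - j) * x j (n - j)
      = aCoeff j (n - i - j) * x i (n - i) := by
  have h1 := hx.cocycle i j (n - i - j) hi hj (by omega)
  have h2 := hx.skew (i + (n - i - j)) j (by omega) hj
  have h3 := hx.skew (j + (n - i - j)) i (by omega) hi
  rw [show i + (n - i - j) = n - j by omega] at h1 h2
  rw [show j + (n - i - j) = n - i by omega] at h1 h3
  rw [show n - i - j = n - (i + j) by omega] at h1 ⊢
  linear_combination h1 + (aCoeff i (n - (i + j)) : F) * h2 - (aCoeff j (n - (i + j)) : F) * h3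

/-- Bracketing with e_1 kills the indices ≡ 1, and skewness then kills those ≡ 0. Bracketing with
e_2 makes every value at an index ≡ 2 beyond 2 equal to -x(2, n - 2), which skewness kills except in
weight 7. -/
theorem weight_eq_zero_of_mod_one (hx : IsCocycleFun x) (h2 : (2 : F) ≠ 0) (hn : n % 3 = 1)
    (h7 : n = 7 → x 2 5 = 0) (h1 : x 1 (n - 1) = 0) {i : ℕ} (hi : 0 < i) (hin : i < n) :
    x i (n - i) = 0 := by
  have one (j : ℕ) (hj : j % 3 = 1) (hjn : j < n) : x j (n - j) = 0 := by
    by_cases hj' : j = n - 1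
    · rw [hx.weight_skew (i := j) (j := 1) (n := n) (by omega) (by omega) (by omega), h1, neg_zero]
    have h := hx.weight_cocycle (n := n) 1 j (by omega) (by omega) (by omega)
    rw [aCoeff_eq_zero (i := 1) (j := j) (by omega), aCoeff_eq_one (j := n - 1 - j) (by omega), h1]
      at h
    simpa using h
  have zero (j : ℕ) (hj : j % 3 = 0) (hj0 : 0 < j) (hjn : j < n) : x j (n - j) = 0 := by
    rw [hx.weight_skew (i := j) (j := n - j) (n := n) hj0 (by omega) (by omega),
      one (n - j) (by omega) (by omega), neg_zero]
  have two (j : ℕ) (hj : j % 3 = 2) (hj2 : 2 < j) (hjn : j < n) :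
      x j (n - j) = -x 2 (n - 2) := by
    have h := hx.weight_cocycle (n := n) 2 (j - 2) (by omega) (by omega) (by omega)
    rw [show 2 + (j - 2) = j by omega, aCoeff_eq_one (i := 2) (j := j - 2) (by omega),
      aCoeff_eq_zero (i := 2) (j := n - 2 - (j - 2)) (by omega),
      aCoeff_eq_neg_one (i := j - 2) (by omega)] at h
    simpa using h
  have hb : x 2 (n - 2) = 0 := by
    obtain rfl | rfl | hn' : n = 4 ∨ n = 7 ∨ 10 ≤ n := by omega
    · have h := hx.skew 2 2 (by omega) (by omega)
      refine (mul_eq_zero.mp (?_ : 2 * x 2 2 = 0)).resolve_left h2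
      linear_combination h
    · exact h7 rfl
    -- The indices 5 and n - 5 are both ≡ 2 (mod 3) and exceed 2, so they carry the same value,
    -- while skewness makes their values opposite. For n = 7 the partner of 5 is 2 itself and
    -- nothing new results.
    · have h := hx.weight_skew (i := 5) (j := n - 5) (n := n) (by omega) (by omega) (by omega)
      rw [two 5 (by omega) (by omega) (by omega), two (n - 5) (by omega) (by omega) (by omega)] at h
      refine (mul_eq_zero.mp (?_ : 2 * x 2 (n - 2) = 0)).resolve_left h2
      linear_combination -h
  obtain h | h | h : i % 3 = 0 ∨ i % 3 = 1 ∨ i % 3 = 2 := by omega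
  · exact zero i h hi hin
  · exact one i h hin
  · by_cases hi2 : i = 2
    · rw [hi2, hb]
    · rw [two i h (by omega) hin, hb, neg_zero]

/-- Bracketing with e_1 makes the values at indices ≡ 1 below n - 1 all equal; skewness then makes
them zero, except in weight 5. Alternating e_1 and e_2 carries the vanishing from index 2 through 3,
5, 6, 8, …. -/
theorem weight_eq_zero_of_mod_two (hx : IsCocycleFun x) (h2 : (2 : F) ≠ 0) (hn : n % 3 = 2)
    (h5 : n = 5 → x 1 4 = 0) (hb : x 2 (n - 2) = 0) {i : ℕ} (hi : 0 < i) (hin : i < n) :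
    x i (n - i) = 0 := by
  have one' (j : ℕ) (hj : j % 3 = 1) (hjn : j < n - 1) : x j (n - j) = x 1 (n - 1) := by
    have h := hx.weight_cocycle (n := n) 1 j (by omega) (by omega) (by omega)
    rw [aCoeff_eq_zero (i := 1) (j := j) (by omega),
      aCoeff_eq_neg_one (i := 1) (j := n - 1 - j) (by omega),
      aCoeff_eq_neg_one (i := j) (j := n - 1 - j) (by omega)] at h
    simpa using h
  have hc : x 1 (n - 1) = 0 := by
    obtain rfl | rfl | hn' : n = 2 ∨ n = 5 ∨ 8 ≤ n := by omega
    · have h := hx.skew 1 1 (by omega) (by omega)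
      refine (mul_eq_zero.mp (?_ : 2 * x 1 1 = 0)).resolve_left h2
      linear_combination h
    · exact h5 rfl
    -- Here 4 and n - 4 are both ≡ 1 (mod 3) and below n - 1; in weight 5 the index 4 equals n - 1
    -- and escapes the recurrence.
    · have h := hx.weight_skew (i := 4) (j := n - 4) (n := n) (by omega) (by omega) (by omega)
      rw [one' 4 (by omega) (by omega), one' (n - 4) (by omega) (by omega)] at h
      refine (mul_eq_zero.mp (?_ : 2 * x 1 (n - 1) = 0)).resolve_left h2
      linear_combination h
  have one (j : ℕ) (hj : j % 3 = 1) (hjn : j < n) : x j (n - j) = 0 := by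
    by_cases hj' : j = n - 1
    · rw [hx.weight_skew (i := j) (j := 1) (n := n) (by omega) (by omega) (by omega), hc, neg_zero]
    · rw [one' j hj (by omega), hc]
  have zero (m : ℕ) (hm : 3 * m + 3 < n) : x (3 * m + 3) (n - (3 * m + 3)) = 0 := by
    have step (m : ℕ) (hm : 3 * m + 3 < n) (h0 : x (3 * m + 2) (n - (3 * m + 2)) = 0) :
        x (3 * m + 3) (n - (3 * m + 3)) = 0 := by
      have h := hx.weight_cocycle (n := n) 1 (3 * m + 2) (by omega) (by omega) (by omega)
      rw [aCoeff_eq_one (i := 1) (j := 3 * m + 2) (by omega), h0, hc,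
        show 1 + (3 * m + 2) = 3 * m + 3 by omega] at h
      simpa using h
    induction m with
    | zero => exact step 0 hm (by simpa using hb)
    | succ m ih =>
      refine step (m + 1) hm ?_
      have h := hx.weight_cocycle (n := n) 2 (3 * m + 3) (by omega) (by omega) (by omega)
      rw [aCoeff_eq_one (i := 2) (j := 3 * m + 3) (by omega), ih (by omega), hb,
        show 2 + (3 * m + 3) = 3 * (m + 1) + 2 by omega] at h
      simpa using h
  obtain h | h | h : i % 3 = 0 ∨ i % 3 = 1 ∨ i % 3 = 2 := by omega
  · obtain ⟨m, rfl⟩ : ∃ m, i = 3 * m + 3 := ⟨i / 3 - 1, by omega⟩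
    exact zero m hin
  · exact one i h hin
  · rw [hx.weight_skew (i := i) (j := n - i) (n := n) (by omega) (by omega) (by omega)]
    obtain ⟨m, hm⟩ : ∃ m, n - i = 3 * m + 3 := ⟨(n - i) / 3 - 1, by omega⟩
    rw [hm, zero m (by omega), neg_zero]

/-- The values at indices 2, 5, 8, … form an arithmetic progression x(2, n - 2), 2x(2, n - 2), ….
Its last term, at index n - 1, is m · x(2, n - 2), and skewness identifies it with -x(1, n - 1) = 0.
-/
theorem weight_eq_zero_of_mod_zero (hx : IsCocycleFun x) {m : ℕ} (hm : (m : F) ≠ 0)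
    (hn : n = 3 * m) (h1 : x 1 (n - 1) = 0) {i : ℕ} (hi : 0 < i) (hin : i < n) :
    x i (n - i) = 0 := by
  have succ (j : ℕ) (hj : j % 3 ≠ 1) (hj0 : 0 < j) (hjn : j + 1 < n) :
      x (j + 1) (n - (j + 1)) = x j (n - j) := by
    have h := hx.weight_cocycle (n := n) 1 j (by omega) (by omega) (by omega)
    rw [h1, mul_zero, add_comm 1 j] at h
    obtain hj' | hj' : j % 3 = 0 ∨ j % 3 = 2 := by omega
    · rw [aCoeff_eq_neg_one (i := 1) (j := j) (by omega),
        aCoeff_eq_one (i := 1) (j := n - 1 - j) (by omega)] at h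
      push_cast at h
      linear_combination -h
    · rw [aCoeff_eq_one (i := 1) (j := j) (by omega),
        aCoeff_eq_neg_one (i := 1) (j := n - 1 - j) (by omega)] at h
      push_cast at h
      linear_combination h
  have two (k : ℕ) (hk : 3 * k + 2 < n) :
      x (3 * k + 2) (n - (3 * k + 2)) = (k + 1) * x 2 (n - 2) := by
    induction k with
    | zero => simp
    | succ k ih =>
      have h := hx.weight_cocycle (n := n) 2 (3 * k + 3) (by omega) (by omega) (by omega)
      rw [aCoeff_eq_one (i := 2) (j := 3 * k + 3) (by omega),
        aCoeff_eq_neg_one (i := 2) (j := n - 2 - (3 * k + 3)) (by omega),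
        aCoeff_eq_one (i := 3 * k + 3) (j := n - 2 - (3 * k + 3)) (by omega),
        succ (3 * k + 2) (by omega) (by omega) (by omega), ih (by omega),
        show 2 + (3 * k + 3) = 3 * (k + 1) + 2 by omega] at h
      push_cast at h ⊢
      linear_combination h
  have hb : x 2 (n - 2) = 0 := by
    obtain ⟨k, rfl⟩ : ∃ k, m = k + 1 := ⟨m - 1, by omega⟩
    have h := hx.weight_skew (i := 3 * k + 2) (j := 1) (n := n) (by omega) (by omega) (by omega)
    rw [two k (by omega), h1, neg_zero] at h
    exact (mul_eq_zero.mp h).resolve_left (by exact_mod_cast hm)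
  have two' (j : ℕ) (hj : j % 3 = 2) (hjn : j < n) : x j (n - j) = 0 := by
    obtain ⟨k, rfl⟩ : ∃ k, j = 3 * k + 2 := ⟨j / 3, by omega⟩
    rw [two k hjn, hb, mul_zero]
  have zero (j : ℕ) (hj : j % 3 = 0) (hj0 : 0 < j) (hjn : j < n) : x j (n - j) = 0 := by
    obtain ⟨k, rfl⟩ : ∃ k, j = k + 1 := ⟨j - 1, by omega⟩
    rw [succ k (by omega) (by omega) hjn, two' k (by omega) (by omega)]
  obtain h | h | h : i % 3 = 0 ∨ i % 3 = 1 ∨ i % 3 = 2 := by omega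
  · exact zero i h hi hin
  · by_cases hi1 : i = 1
    · rw [hi1, h1]
    obtain ⟨k, rfl⟩ : ∃ k, i = k + 1 := ⟨i - 1, by omega⟩
    rw [succ k (by omega) (by omega) hin, zero k (by omega) (by omega) (by omega)]
  · exact two' i h hin

end IsCocycleFun

end Weight

/-! ### Cochains of g(p) through their values on basis vectors -/

section TruncCochains

variable {F : Type*} [Field F] {p : ℕ}

/-- Evaluation of 2-cochains at `x ∧ y`. -/
def Cochain.evalPair {L : Type*} [LieRing L] [LieAlgebra F L] (x y : L) :
    Cochain F L 2 →ₗ[F] F where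
  toFun φ := φ ![x, y]
  map_add' _ _ := rfl
  map_smul' _ _ := rfl

theorem Cochain.apply_swap {L : Type*} [LieRing L] [LieAlgebra F L] (φ : Cochain F L 2) (x y : L) :
    φ ![x, y] = -φ ![y, x] := by
  have h := φ.apply_self (x + y)
  rw [φ.apply_add_left, φ.apply_add_right, φ.apply_add_right, φ.apply_self, φ.apply_self] at h
  linear_combination h

theorem lie_truncE (i j : ℕ+) :
    ⁅truncE F p i, truncE F p j⁆ = (aCoeff i j : F) • truncE F p (i + j) := by
  have h := congrArg (LieSubmodule.Quotient.mk (N := truncIdeal F p)) (NPlus.lie_e (F := F) i j)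
  exact h

theorem truncE_eq_zero (hp : ¬ 3 ∣ p) {i : ℕ+} (hi : p < i) : truncE F p i = 0 :=
  (LieSubmodule.Quotient.mk_eq_zero (truncIdeal F p)).mpr (e_mem_truncIdeal F p hp i hi)

/-- The value of a 2-cochain at `e_i ∧ e_j`, as a function of natural numbers `i, j ≥ 1`. -/
noncomputable def Cochain.val (φ : Cochain F (TruncNPlus F p) 2) (i j : ℕ) : F :=
  φ ![truncE F p i.toPNat', truncE F p j.toPNat']

theorem Cochain.val_coe (φ : Cochain F (TruncNPlus F p) 2) (i j : ℕ+) :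
    φ.val i j = φ ![truncE F p i, truncE F p j] := by
  simp [Cochain.val]

theorem Cochain.val_eq_zero_of_lt_left (hp : ¬ 3 ∣ p) (φ : Cochain F (TruncNPlus F p) 2)
    {i : ℕ} (j : ℕ) (hi : p < i) : φ.val i j = 0 := by
  lift i to ℕ+ using by omega
  rw [Cochain.val, PNat.coe_toPNat', truncE_eq_zero hp hi, φ.apply_zero_left]

theorem Cochain.val_eq_zero_of_lt_right (hp : ¬ 3 ∣ p) (φ : Cochain F (TruncNPlus F p) 2)
    (i : ℕ) {j : ℕ} (hj : p < j) : φ.val i j = 0 := by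
  rw [Cochain.val, φ.apply_swap, neg_eq_zero]
  exact φ.val_eq_zero_of_lt_left hp i hj

theorem ceD2_truncE (φ : Cochain F (TruncNPlus F p) 2) (i j k : ℕ+) :
    ceD2 F (TruncNPlus F p) φ ![truncE F p i, truncE F p j, truncE F p k]
      = aCoeff i j * φ.val (i + j : ℕ) k - aCoeff i k * φ.val (i + k : ℕ) j
        + aCoeff j k * φ.val (j + k : ℕ) i := by
  show φ ![⁅truncE F p i, truncE F p j⁆, truncE F p k]
    - φ ![⁅truncE F p i, truncE F p k⁆, truncE F p j]
    + φ ![⁅truncE F p j, truncE F p k⁆, truncE F p i] = _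
  simp only [lie_truncE, Cochain.apply_smul_left, ← PNat.add_coe, Cochain.val_coe]

theorem Cochain.ext_truncE (hp : ¬ 3 ∣ p) {q : ℕ} {φ φ' : Cochain F (TruncNPlus F p) q}
    (h : ∀ v : Fin q → ℕ+, φ (fun a => truncE F p (v a)) = φ' fun a => truncE F p (v a)) :
    φ = φ' := by
  obtain ⟨b, hb⟩ := exists_basis_truncE F p hp
  refine Module.Basis.ext_alternating (f := (φ : _ [⋀^Fin q]→ₗ[F] F)) (g := φ') b fun v _ => ?_
  simp only [(hb _).1]
  exact h _

theorem Cochain.ext_val (hp : ¬ 3 ∣ p) {φ φ' : Cochain F (TruncNPlus F p) 2}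
    (h : ∀ i j, 0 < i → 0 < j → φ.val i j = φ'.val i j) : φ = φ' := by
  refine Cochain.ext_truncE hp fun v => ?_
  have e : (fun a => truncE F p (v a)) = ![truncE F p (v 0), truncE F p (v 1)] := by
    ext a
    fin_cases a <;> rfl
  rw [e, ← Cochain.val_coe, ← Cochain.val_coe]
  exact h _ _ (v 0).pos (v 1).pos

/-- An alternating form is determined on basis vectors, and the formula for the differential
persists for indices beyond p, where the classes are zero. Being a cocycle thus becomes an identity
on all positive integers. -/
theorem mem_ker_ceD2_iff (hp : ¬ 3 ∣ p) (φ : Cochain F (TruncNPlus F p) 2) :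
    φ ∈ LinearMap.ker (ceD2 F (TruncNPlus F p)) ↔ IsCocycleFun φ.val := by
  rw [LinearMap.mem_ker]
  constructor
  · refine fun h => ⟨fun i j _ _ => φ.apply_swap _ _, fun i j k hi hj hk => ?_⟩
    lift i to ℕ+ using hi
    lift j to ℕ+ using hj
    lift k to ℕ+ using hk
    rw [← ceD2_truncE, h, Cochain.zero_apply]
  · refine fun h => Cochain.ext_truncE hp fun v => ?_
    have e : (fun a => truncE F p (v a))
        = ![truncE F p (v 0), truncE F p (v 1), truncE F p (v 2)] := by
      ext a
      fin_cases a <;> rfl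
    rw [e, ceD2_truncE]
    exact h.cocycle _ _ _ (v 0).pos (v 1).pos (v 2).pos

theorem dualE2_val {a b : ℕ} (ha : 0 < a) (hap : a ≤ p) (hb : 0 < b) (hbp : b ≤ p) {i j : ℕ}
    (hi : 0 < i) (hj : 0 < j) :
    (dualE2 F p a b).val i j = (if i = a then 1 else 0) * (if j = b then 1 else 0)
      - (if j = a then 1 else 0) * (if i = b then 1 else 0) := by
  lift i to ℕ+ using hi
  lift j to ℕ+ using hj
  rw [Cochain.val_coe]
  show dualE F p a (truncE F p i) * dualE F p b (truncE F p j)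
    - dualE F p a (truncE F p j) * dualE F p b (truncE F p i) = _
  simp only [dualE_truncE F p _ ha hap, dualE_truncE F p _ hb hbp]

theorem mem_Icc_sIdx (k i : ℕ) : i ∈ Finset.Icc 1 (sIdx k) ↔ 0 < i ∧ i < k - i := by
  rw [Finset.mem_Icc, sIdx]
  split_ifs with h
  · rw [Nat.even_iff] at h
    omega
  · rw [Nat.even_iff] at h
    omega

/-- The bound k ≤ p + 1 keeps both indices of every summand at most p, away from the default value 0
of `dualE`. At most one summand is then nonzero at e_i ∧ e_j, the one indexed by the smaller of i
and j. -/
theorem phi_val {k : ℕ} (hk : k ≤ p + 1) {i j : ℕ} (hi : 0 < i) (hj : 0 < j) :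
    (phi F p k).val i j = if i + j = k then (aCoeff i j : F) else 0 := by
  have h : (phi F p k).val i j
      = ∑ a ∈ Finset.Icc 1 (sIdx k), (aCoeff a (k - a) : F) * (dualE2 F p a (k - a)).val i j := by
    show Cochain.evalPair (truncE F p i.toPNat') (truncE F p j.toPNat') (phi F p k) = _
    rw [phi, mIdx, if_pos hk, map_sum]
    rfl
  have h' : ∀ a ∈ Finset.Icc 1 (sIdx k), (dualE2 F p a (k - a)).val i j
      = (if i = a then 1 else 0) * (if j = k - a then 1 else 0)
        - (if j = a then 1 else 0) * (if i = k - a then 1 else 0) := fun a ha => by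
    rw [mem_Icc_sIdx] at ha
    exact dualE2_val (by omega) (by omega) (by omega) (by omega) hi hj
  rw [h, Finset.sum_congr rfl fun a ha => by rw [h' a ha]]
  have zero (a : ℕ) (ha : a ∈ Finset.Icc 1 (sIdx k)) (hai : ¬ (i = a ∧ j = k - a))
      (haj : ¬ (j = a ∧ i = k - a)) : (aCoeff a (k - a) : F)
        * ((if i = a then 1 else 0) * (if j = k - a then 1 else 0)
          - (if j = a then 1 else 0) * (if i = k - a then 1 else 0)) = 0 := by
    split_ifs <;> first | tauto | simp
  split_ifs with hk
  · rcases lt_trichotomy i j with hij | rfl | hij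
    · rw [Finset.sum_eq_single i]
      · simp [show k - i = j by omega, show j ≠ i by omega]
      · intro a ha hai
        rw [mem_Icc_sIdx] at ha
        exact zero a ((mem_Icc_sIdx k a).2 ha) (by omega) (by omega)
      · exact fun h => absurd ((mem_Icc_sIdx k i).2 (by omega)) h
    · rw [aCoeff_self, Int.cast_zero]
      refine Finset.sum_eq_zero fun a ha => ?_
      have ha' := (mem_Icc_sIdx k a).1 ha
      exact zero a ha (by omega) (by omega)
    · rw [Finset.sum_eq_single j]
      · rw [aCoeff_skew j i]
        simp [show k - j = i by omega, show i ≠ j by omega]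
      · intro a ha hai
        rw [mem_Icc_sIdx] at ha
        exact zero a ((mem_Icc_sIdx k a).2 ha) (by omega) (by omega)
      · exact fun h => absurd ((mem_Icc_sIdx k j).2 (by omega)) h
  · refine Finset.sum_eq_zero fun a ha => ?_
    have ha' := (mem_Icc_sIdx k a).1 ha
    exact zero a ha (by omega) (by omega)

theorem ceD1_dualE (hp : ¬ 3 ∣ p) {k : ℕ} (hk0 : 0 < k) (hk : k ≤ p) :
    ceD1 F (TruncNPlus F p) (dualE F p k) = phi F p k := by
  refine Cochain.ext_val hp fun i j hi hj => ?_
  rw [phi_val (by omega) hi hj]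
  lift i to ℕ+ using hi
  lift j to ℕ+ using hj
  rw [Cochain.val_coe]
  show dualE F p k ⁅truncE F p i, truncE F p j⁆ = _
  rw [lie_truncE, map_smul, dualE_truncE F p k hk0 hk, smul_eq_mul, PNat.add_coe, mul_ite,
    mul_one, mul_zero]

/-- In weight k the cocycle identity is the Jacobi identity for the structure constants, which also
covers k = p + 1, where no `dualE` is available to produce φ_k as a coboundary. -/
theorem phi_mem_ker (hp : ¬ 3 ∣ p) {k : ℕ} (hk : k ≤ p + 1) :
    phi F p k ∈ LinearMap.ker (ceD2 F (TruncNPlus F p)) := by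
  refine (mem_ker_ceD2_iff hp _).2 ⟨fun i j _ _ => Cochain.apply_swap _ _ _, ?_⟩
  intro i j l hi hj hl
  rw [phi_val hk (by omega) (by omega), phi_val hk (by omega) (by omega),
    phi_val hk (by omega) (by omega)]
  by_cases h : i + j + l = k
  · rw [if_pos h, if_pos (by omega), if_pos (by omega), aCoeff_skew i (j + l),
      aCoeff_skew j (i + l)]
    have h' := congrArg (Int.cast : ℤ → F) (aCoeff_jacobi i j l)
    push_cast at h' ⊢
    linear_combination -h'
  · rw [if_neg h, if_neg (by omega), if_neg (by omega)]
    simp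

/-- The value of `e^{a,b}` at `e_i ∧ e_j`, as an integer. -/
def wedgeCoeff (a b i j : ℕ) : ℤ :=
  (if i = a then 1 else 0) * (if j = b then 1 else 0)
    - (if j = a then 1 else 0) * (if i = b then 1 else 0)

/-- Only triples of total weight a + b can contribute, so for explicit a and b the cocycle condition
is a finite check over the integers, independent of F and p. -/
theorem dualE2_mem_ker (hp : ¬ 3 ∣ p) {a b : ℕ} (ha : 0 < a) (hap : a ≤ p) (hb : 0 < b)
    (hbp : b ≤ p)
    (h : ∀ i < a + b, ∀ j < a + b - i, 0 < i → 0 < j →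
      aCoeff i j * wedgeCoeff a b (i + j) (a + b - i - j)
        - aCoeff i (a + b - i - j) * wedgeCoeff a b (i + (a + b - i - j)) j
        + aCoeff j (a + b - i - j) * wedgeCoeff a b (j + (a + b - i - j)) i = 0) :
    dualE2 F p a b ∈ LinearMap.ker (ceD2 F (TruncNPlus F p)) := by
  have hval {i j : ℕ} (hi : 0 < i) (hj : 0 < j) :
      (dualE2 F p a b).val i j = (wedgeCoeff a b i j : F) := by
    rw [dualE2_val ha hap hb hbp hi hj, wedgeCoeff]
    split_ifs <;> simp
  have hzero {i j : ℕ} (hij : i + j ≠ a + b) : wedgeCoeff a b i j = 0 := by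
    rw [wedgeCoeff]
    split_ifs <;> omega
  refine (mem_ker_ceD2_iff hp _).2 ⟨fun i j _ _ => Cochain.apply_swap _ _ _, ?_⟩
  intro i j l hi hj hl
  rw [hval (by omega) (by omega), hval (by omega) (by omega), hval (by omega) (by omega)]
  by_cases hl' : i + j + l = a + b
  · obtain rfl : l = a + b - i - j := by omega
    exact_mod_cast congrArg (Int.cast : ℤ → F) (h i (by omega) j (by omega) hi hj)
  · rw [hzero (by omega), hzero (by omega), hzero (by omega)]
    simp

theorem dualE2_one_four_mem_ker (hp : ¬ 3 ∣ p) (h4 : 4 ≤ p) :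
    dualE2 F p 1 4 ∈ LinearMap.ker (ceD2 F (TruncNPlus F p)) :=
  dualE2_mem_ker hp (by omega) (by omega) (by omega) (by omega) (by decide)

theorem dualE2_two_five_mem_ker (hp : ¬ 3 ∣ p) (h5 : 5 ≤ p) :
    dualE2 F p 2 5 ∈ LinearMap.ker (ceD2 F (TruncNPlus F p)) :=
  dualE2_mem_ker hp (by omega) (by omega) (by omega) (by omega) (by decide)

end TruncCochains

/-! ### The basis of the cocycle space -/

section CocycleBasis

variable {F : Type*} [Field F] {p : ℕ}

/-- For `k ≥ 3`, an index `i < k - i` with `a_{i,k-i} = ±1`. -/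
def leadIdx (k : ℕ) : ℕ := if k % 3 = 2 then 2 else 1

theorem leadIdx_pos (k : ℕ) : 0 < leadIdx k := by
  rw [leadIdx]
  split_ifs <;> omega

theorem leadIdx_lt {k : ℕ} (hk : 3 ≤ k) : leadIdx k < k - leadIdx k := by
  rw [leadIdx]
  split_ifs <;> omega

theorem aCoeff_leadIdx {k : ℕ} (hk : 3 ≤ k) :
    aCoeff (leadIdx k) (k - leadIdx k) = 1 ∨ aCoeff (leadIdx k) (k - leadIdx k) = -1 := by
  rw [leadIdx]
  split_ifs with h
  · exact .inl (aCoeff_eq_one (by omega))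
  · obtain h | h : k % 3 = 0 ∨ k % 3 = 1 := by omega
    · exact .inl (aCoeff_eq_one (by omega))
    · exact .inr (aCoeff_eq_neg_one (by omega))

theorem aCoeff_leadIdx_mul_self {k : ℕ} (hk : 3 ≤ k) :
    (aCoeff (leadIdx k) (k - leadIdx k) : F) * aCoeff (leadIdx k) (k - leadIdx k) = 1 := by
  rcases aCoeff_leadIdx hk with h | h <;> simp [h]

/-- A 2-cocycle of `g(p)` vanishes if it does so at `e_1 ∧ e_4`, at `e_2 ∧ e_5` and at one
`e_i ∧ e_{k-i}` for each `3 ≤ k ≤ p + 1`. -/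
theorem eq_zero_of_mem_ker [Fact p.Prime] [CharP F p] (hp : 5 ≤ p)
    {φ : Cochain F (TruncNPlus F p) 2} (hφ : φ ∈ LinearMap.ker (ceD2 F (TruncNPlus F p)))
    (h14 : φ.val 1 4 = 0) (h25 : φ.val 2 5 = 0)
    (h : ∀ k, 3 ≤ k → k ≤ p + 1 → φ.val (leadIdx k) (k - leadIdx k) = 0) : φ = 0 := by
  have hprime : p.Prime := Fact.out
  have hp3 : ¬ 3 ∣ p := fun h3 => by
    have := (Nat.prime_dvd_prime_iff_eq Nat.prime_three hprime).mp h3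
    omega
  have cast_ne (m : ℕ) (hm0 : 0 < m) (hm : m < p) : (m : F) ≠ 0 := fun h0 =>
    absurd (Nat.le_of_dvd hm0 ((CharP.cast_eq_zero_iff F p m).mp h0)) (by omega)
  have hx := (mem_ker_ceD2_iff hp3 φ).mp hφ
  have two_ne : (2 : F) ≠ 0 := by exact_mod_cast cast_ne 2 (by omega) (by omega)
  have lead (k : ℕ) (hk : 3 ≤ k) : φ.val (leadIdx k) (k - leadIdx k) = 0 := by
    by_cases hkp : k ≤ p + 1
    · exact h k hk hkp
    -- The second index exceeds p. The only doubtful case is k = p + 2 with `leadIdx k` equal to 2,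
    -- and there k ≡ 2 (mod 3) would force 3 ∣ p.
    · refine φ.val_eq_zero_of_lt_right hp3 _ ?_
      rw [leadIdx]
      split_ifs <;> omega
  refine Cochain.ext_val hp3 fun i j hi hj => ?_
  show φ.val i j = 0
  by_cases hip : p < i
  · exact φ.val_eq_zero_of_lt_left hp3 j hip
  by_cases hjp : p < j
  · exact φ.val_eq_zero_of_lt_right hp3 i hjp
  obtain ⟨n, rfl⟩ : ∃ n, j = n - i := ⟨i + j, by omega⟩
  -- Weight 2 contains only e_1 ∧ e_1 and has no leading pair.
  by_cases hn : n = 2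
  · obtain rfl : i = 1 := by omega
    rw [hn]
    exact φ.apply_self _
  have hl := lead n (by omega)
  rw [leadIdx] at hl
  obtain h3 | h3 | h3 : n % 3 = 0 ∨ n % 3 = 1 ∨ n % 3 = 2 := by omega
  · rw [if_neg (by omega)] at hl
    -- Both indices are at most p, so n ≤ 2p and 0 < n / 3 < p.
    exact hx.weight_eq_zero_of_mod_zero (m := n / 3) (cast_ne _ (by omega) (by omega)) (by omega)
      hl hi (by omega)
  · rw [if_neg (by omega)] at hl
    exact hx.weight_eq_zero_of_mod_one two_ne h3 (fun _ => h25) hl hi (by omega)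
  · rw [if_pos h3] at hl
    exact hx.weight_eq_zero_of_mod_two two_ne h3 (fun _ => h14) hl hi (by omega)

/-- The family `e^{1,4}, e^{2,5}, φ_3, …, φ_{p+1}`. -/
noncomputable def cocycleFamily (F : Type*) [Field F] (p : ℕ) :
    Fin 2 ⊕ {k : ℕ // 3 ≤ k ∧ k ≤ p + 1} → Cochain F (TruncNPlus F p) 2 :=
  Sum.elim ![dualE2 F p 1 4, dualE2 F p 2 5] fun k => phi F p k

/-- Linear forms dual to the family `e^{1,4}, e^{2,5}, φ_3, …, φ_{p+1}`. -/
noncomputable def cocycleCoord (F : Type*) [Field F] (p : ℕ) :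
    Fin 2 ⊕ {k : ℕ // 3 ≤ k ∧ k ≤ p + 1} → Cochain F (TruncNPlus F p) 2 → F :=
  Sum.elim ![fun φ => φ.val 1 4, fun φ => φ.val 2 5] fun k φ =>
    aCoeff (leadIdx k) (k - leadIdx k) * φ.val (leadIdx k) (k - leadIdx k)

theorem Cochain.val_sum {ι : Type*} (s : Finset ι) (c : ι → F)
    (f : ι → Cochain F (TruncNPlus F p) 2) (i j : ℕ) :
    (∑ a ∈ s, c a • f a).val i j = ∑ a ∈ s, c a * (f a).val i j := by
  have h := map_sum (Cochain.evalPair (truncE F p i.toPNat') (truncE F p j.toPNat'))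
    (fun a => c a • f a) s
  exact h

theorem cocycleCoord_sum {ι : Type*} (s : Finset ι) (c : ι → F)
    (f : ι → Cochain F (TruncNPlus F p) 2) (a : Fin 2 ⊕ {k : ℕ // 3 ≤ k ∧ k ≤ p + 1}) :
    cocycleCoord F p a (∑ b ∈ s, c b • f b) = ∑ b ∈ s, c b * cocycleCoord F p a (f b) := by
  rcases a with a | k
  · fin_cases a <;> exact Cochain.val_sum s c f _ _
  · show _ * (∑ b ∈ s, c b • f b).val _ _ = ∑ b ∈ s, c b * (_ * (f b).val _ _)
    rw [Cochain.val_sum, Finset.mul_sum]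
    exact Finset.sum_congr rfl fun b _ => mul_left_comm _ _ _

/-- The special forms do not interfere with φ_5 and φ_7: the leading pairs in weights 5 and 7 are
(2, 3) and (1, 6), whereas a_{1,4} = a_{2,5} = 0. -/
theorem cocycleCoord_cocycleFamily (hp : 5 ≤ p)
    (a b : Fin 2 ⊕ {k : ℕ // 3 ≤ k ∧ k ≤ p + 1}) :
    cocycleCoord F p a (cocycleFamily F p b) = if a = b then 1 else 0 := by
  have v14 {i j : ℕ} (hi : 0 < i) (hj : 0 < j) := dualE2_val (F := F) (p := p) (a := 1) (b := 4)
    (by omega) (by omega) (by omega) (by omega) hi hj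
  have v25 {i j : ℕ} (hi : 0 < i) (hj : 0 < j) := dualE2_val (F := F) (p := p) (a := 2) (b := 5)
    (by omega) (by omega) (by omega) (by omega) hi hj
  rcases b with b | ⟨k, hk3, hkp⟩
  · rcases a with a | ⟨l, hl3, hlp⟩
    · fin_cases a <;> fin_cases b
      · show (dualE2 F p 1 4).val 1 4 = _
        rw [v14 (by omega) (by omega)]
        simp
      · show (dualE2 F p 2 5).val 1 4 = _
        rw [v25 (by omega) (by omega)]
        simp
      · show (dualE2 F p 1 4).val 2 5 = _
        rw [v14 (by omega) (by omega)]
        simp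
      · show (dualE2 F p 2 5).val 2 5 = _
        rw [v25 (by omega) (by omega)]
        simp
    · rw [if_neg (by simp)]
      have h0 := leadIdx_pos l
      have h1 := leadIdx_lt hl3
      have h2 : leadIdx l = if l % 3 = 2 then 2 else 1 := rfl
      fin_cases b
      · show _ * (dualE2 F p 1 4).val (leadIdx l) (l - leadIdx l) = _
        rw [v14 h0 (by omega)]
        split_ifs at h2 ⊢ <;> first | omega | simp
      · show _ * (dualE2 F p 2 5).val (leadIdx l) (l - leadIdx l) = _
        rw [v25 h0 (by omega)]
        split_ifs at h2 ⊢ <;> first | omega | simp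
  · rcases a with a | ⟨l, hl3, hlp⟩
    · rw [if_neg (by simp)]
      fin_cases a
      · show (phi F p k).val 1 4 = 0
        rw [phi_val hkp (by omega) (by omega), aCoeff_eq_zero (by omega)]
        simp
      · show (phi F p k).val 2 5 = 0
        rw [phi_val hkp (by omega) (by omega), aCoeff_eq_zero (by omega)]
        simp
    · show _ * (phi F p k).val (leadIdx l) (l - leadIdx l) = _
      have h1 := leadIdx_lt hl3
      rw [phi_val hkp (leadIdx_pos l) (by omega), show leadIdx l + (l - leadIdx l) = l by omega]
      by_cases hlk : l = k
      · subst hlk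
        simp [aCoeff_leadIdx_mul_self hl3]
      · simp [hlk]

theorem cocycleFamily_mem_ker (hp : 5 ≤ p) (hp3 : ¬ 3 ∣ p)
    (a : Fin 2 ⊕ {k : ℕ // 3 ≤ k ∧ k ≤ p + 1}) :
    cocycleFamily F p a ∈ LinearMap.ker (ceD2 F (TruncNPlus F p)) := by
  rcases a with a | k
  · fin_cases a
    · exact dualE2_one_four_mem_ker hp3 (by omega)
    · exact dualE2_two_five_mem_ker hp3 hp
  · exact phi_mem_ker hp3 k.2.2

instance instFintypeWeight (p : ℕ) : Fintype {k : ℕ // 3 ≤ k ∧ k ≤ p + 1} :=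
  Fintype.subtype (Finset.Icc 3 (p + 1)) fun _ => Finset.mem_Icc

theorem exists_cocycleBasis [Fact p.Prime] [CharP F p] (hp : 5 ≤ p) (hp3 : ¬ 3 ∣ p) :
    ∃ B : Module.Basis (Fin 2 ⊕ {k : ℕ // 3 ≤ k ∧ k ≤ p + 1}) F
        (LinearMap.ker (ceD2 F (TruncNPlus F p))),
      ∀ a, (B a : Cochain F (TruncNPlus F p) 2) = cocycleFamily F p a := by
  set K := LinearMap.ker (ceD2 F (TruncNPlus F p)) with hK
  let v : Fin 2 ⊕ {k : ℕ // 3 ≤ k ∧ k ≤ p + 1} → K :=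
    fun a => ⟨cocycleFamily F p a, cocycleFamily_mem_ker hp hp3 a⟩
  have coe_sum (c : Fin 2 ⊕ {k : ℕ // 3 ≤ k ∧ k ≤ p + 1} → F) :
      ((∑ a, c a • v a : K) : Cochain F (TruncNPlus F p) 2) = ∑ a, c a • cocycleFamily F p a := by
    simp [v]
  have coord_sum (c : Fin 2 ⊕ {k : ℕ // 3 ≤ k ∧ k ≤ p + 1} → F) (a) :
      cocycleCoord F p a (∑ a, c a • cocycleFamily F p a) = c a := by
    rw [cocycleCoord_sum]
    simp [cocycleCoord_cocycleFamily hp]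
  have hli : LinearIndependent F v := by
    rw [Fintype.linearIndependent_iff]
    intro c hc a
    have h := coord_sum c a
    rw [← coe_sum, hc] at h
    rw [← h]
    -- The empty sum shows that the coordinates of the zero cochain vanish.
    simpa using cocycleCoord_sum ∅ (0 : Fin 2 → F) 0 a
  have hsp : ⊤ ≤ Submodule.span F (Set.range v) := by
    rintro φ -
    -- The combination with the same coordinates as φ; the difference is a cocycle with all
    -- coordinates zero, hence zero.
    set s : K := ∑ a, cocycleCoord F p a φ • v a with hs
    have coord_sub (a) : cocycleCoord F p a ((φ : Cochain F (TruncNPlus F p) 2) - s) = 0 := by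
      have h := cocycleCoord_sum (F := F) (p := p) Finset.univ ![1, -1]
        ![(φ : Cochain F (TruncNPlus F p) 2), s] a
      simp only [Fin.sum_univ_two, Matrix.cons_val_zero, Matrix.cons_val_one, one_smul,
        neg_smul, ← sub_eq_add_neg, one_mul, neg_mul] at h
      rw [h, hs, coe_sum, coord_sum, sub_self]
    have h : (φ : Cochain F (TruncNPlus F p) 2) - s = 0 := by
      refine eq_zero_of_mem_ker hp (K.sub_mem φ.2 s.2) (coord_sub (.inl 0)) (coord_sub (.inl 1)) ?_
      intro k hk3 hkp
      refine (mul_eq_zero.mp (coord_sub (.inr ⟨k, hk3, hkp⟩))).resolve_left ?_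
      exact left_ne_zero_of_mul_eq_one (aCoeff_leadIdx_mul_self hk3)
    have h' : φ = s := Subtype.ext (sub_eq_zero.mp h)
    rw [h', hs]
    exact Submodule.sum_mem _ fun a _ => Submodule.smul_mem _ _ (Submodule.subset_span ⟨a, rfl⟩)
  exact ⟨Module.Basis.mk hli hsp, fun a => by rw [Module.Basis.mk_apply]⟩

end CocycleBasis

/-! ### Bases of quotients, and the cohomology of g(p) -/

section Quotient

/-- If a subspace is spanned by a part of a basis, then the classes of the other basis vectors are a
basis of the quotient. -/
theorem exists_basis_quotient {F V ι κ : Type*} [Field F] [AddCommGroup V] [Module F V] [Finite ι]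
    [Finite κ] (B : Module.Basis ι F V) (f : κ → ι) (hf : Function.Injective f)
    (W : Submodule F V) (hW : W = Submodule.span F (B '' (Set.range f)ᶜ)) :
    ∃ b : Module.Basis κ F (V ⧸ W), ∀ a, b a = Submodule.Quotient.mk (B (f a)) := by
  classical
  have := Fintype.ofFinite κ
  -- The projection onto the retained coordinates is surjective with kernel W, so it identifies the
  -- quotient with κ → F.
  let g : V →ₗ[F] κ → F := LinearMap.pi fun a => B.coord (f a)
  have hg (a : κ) : g (B (f a)) = Pi.single a 1 := by
    ext c
    simp [g, Finsupp.single_apply, Pi.single_apply, hf.eq_iff, eq_comm]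
  have hsurj : Function.Surjective g := by
    rw [← LinearMap.range_eq_top, eq_top_iff, ← (Pi.basisFun F κ).span_eq, Submodule.span_le]
    rintro _ ⟨a, rfl⟩
    exact ⟨B (f a), by rw [hg, Pi.basisFun_apply]⟩
  have hker : LinearMap.ker g = W := by
    ext x
    rw [hW, Module.Basis.mem_span_image, LinearMap.mem_ker, funext_iff]
    simp only [g, LinearMap.pi_apply, Module.Basis.coord_apply, Pi.zero_apply]
    constructor
    · rintro h i hi ⟨a, rfl⟩
      exact Finsupp.mem_support_iff.mp hi (h a)
    · intro h a
      by_contra h'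
      exact h (Finsupp.mem_support_iff.mpr h') ⟨a, rfl⟩
  subst hker
  refine ⟨Module.Basis.ofEquivFun (g.quotKerEquivOfSurjective hsurj), fun a => ?_⟩
  rw [Module.Basis.coe_ofEquivFun, LinearEquiv.symm_apply_eq]
  exact (hg a).symm

end Quotient

theorem mainTheorem1 (p : ℕ) [Fact p.Prime] (hp : 5 ≤ p) (F : Type*) [Field F] [CharP F p] :
    ∃ B : Module.Basis (Fin 2 ⊕ {k : ℕ // 3 ≤ k ∧ k ≤ p + 1}) F
        (LinearMap.ker (ceD2 F (TruncNPlus F p))),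
      (B (Sum.inl 0) : Cochain F (TruncNPlus F p) 2) = dualE2 F p 1 4 ∧
      (B (Sum.inl 1) : Cochain F (TruncNPlus F p) 2) = dualE2 F p 2 5 ∧
      (∀ k, (B (Sum.inr k) : Cochain F (TruncNPlus F p) 2) = phi F p k) ∧
      Module.finrank F (LinearMap.ker (ceD2 F (TruncNPlus F p))) = p + 1 ∧
      (∀ k : ℕ, 3 ≤ k → k ≤ p → phi F p k = ceD1 F (TruncNPlus F p) (dualE F p k)) ∧
      Module.finrank F (H2 F (TruncNPlus F p)) = 3 ∧
      ∃ b : Module.Basis (Fin 3) F (H2 F (TruncNPlus F p)),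
        b 0 = Submodule.Quotient.mk (B (Sum.inl 0)) ∧
        b 1 = Submodule.Quotient.mk (B (Sum.inl 1)) ∧
        b 2 = Submodule.Quotient.mk (B (Sum.inr ⟨p + 1, by omega, le_rfl⟩)) := by
  have hprime : p.Prime := Fact.out
  have hp3 : ¬ 3 ∣ p := fun h3 => by
    have := (Nat.prime_dvd_prime_iff_eq Nat.prime_three hprime).mp h3
    omega
  obtain ⟨B, hB⟩ := exists_cocycleBasis (F := F) hp hp3
  let f : Fin 3 → Fin 2 ⊕ {k : ℕ // 3 ≤ k ∧ k ≤ p + 1} :=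
    ![.inl 0, .inl 1, .inr ⟨p + 1, by omega, le_rfl⟩]
  have hf : Function.Injective f := by
    intro a c h
    fin_cases a <;> fin_cases c <;> simp [f] at h ⊢
  have hW : coboundaries2 F (TruncNPlus F p) = Submodule.span F (B '' (Set.range f)ᶜ) := by
    have hBd (k : ℕ) (hk3 : 3 ≤ k) (hkp : k ≤ p) :
        (ceD1 F (TruncNPlus F p)).codRestrict (LinearMap.ker (ceD2 F (TruncNPlus F p)))
          (fun ψ => LinearMap.mem_ker.mpr (ceD2_ceD1 F _ ψ)) (dualE F p k)
          = B (.inr ⟨k, hk3, by omega⟩) := by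
      refine Subtype.ext ?_
      rw [hB, LinearMap.codRestrict_apply, ceD1_dualE hp3 (by omega) hkp]
      rfl
    apply le_antisymm
    · obtain ⟨b, hb⟩ := exists_basis_truncE F p hp3
      rw [coboundaries2, LinearMap.range_eq_map, ← b.dualBasis.span_eq, Submodule.map_span,
        Submodule.span_le]
      rintro _ ⟨_, ⟨i, rfl⟩, rfl⟩
      rw [b.coe_dualBasis, (hb i).2]
      by_cases hi : 3 ≤ (i : ℕ) + 1
      · rw [hBd _ hi (by omega)]
        refine Submodule.subset_span ⟨_, ?_, rfl⟩
        rintro ⟨a, ha⟩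
        have := i.2
        fin_cases a <;> simp [f] at ha
        omega
      -- This is the case of e^1 and e^2, whose differentials vanish: only the pair (1, 1) could
      -- have weight at most 2, and a_{1,1} = 0.
      · rw [SetLike.mem_coe]
        convert Submodule.zero_mem _
        refine Subtype.ext ?_
        rw [LinearMap.codRestrict_apply, ceD1_dualE hp3 (by omega) (by omega)]
        refine Cochain.ext_val hp3 fun c d hc hd => ?_
        rw [phi_val (by omega) hc hd]
        show _ = (0 : F)
        split_ifs with h
        · rw [show c = 1 by omega, show d = 1 by omega, aCoeff_self, Int.cast_zero]
        · rfl
    · rw [Submodule.span_le]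
      rintro _ ⟨a, ha, rfl⟩
      rcases a with a | ⟨k, hk3, hkp⟩
      · refine absurd ?_ ha
        fin_cases a
        · exact ⟨0, rfl⟩
        · exact ⟨1, rfl⟩
      · by_cases hk : k ≤ p
        · exact ⟨dualE F p k, hBd k hk3 hk⟩
        -- The form φ_{p+1} is one of the three retained basis vectors, so it is excluded here.
        · obtain rfl : k = p + 1 := by omega
          exact absurd ⟨2, rfl⟩ ha
  obtain ⟨b, hb⟩ := exists_basis_quotient B f hf _ hW
  refine ⟨B, hB _, hB _, fun k => hB _, ?_, fun k hk3 hkp => (ceD1_dualE hp3 (by omega) hkp).symm,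
    ?_, b, hb 0, hb 1, hb 2⟩
  · rw [Module.finrank_eq_card_basis B, Fintype.card_sum, Fintype.card_fin,
      Fintype.card_of_subtype (Finset.Icc 3 (p + 1)) fun _ => Finset.mem_Icc, Nat.card_Icc]
    omega
  · rw [Module.finrank_eq_card_basis b, Fintype.card_fin]
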